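/- All groups are finite. For a group $G$, $\Phi(G)$ denotes the intersection of all maximal subgroups of $G$ (with $\Phi(G)=G$ if $G=1$), and $M_G$ denotes the core of a subgroup $M$, i.e. the largest normal subgroup of $G$ contained in $M$. A chief factor of $G$ is a quotient $H/K$, where $K<H$ are normal subgroups of $G$ with no normal subgroup of $G$ strictly between them; it is non-Frattini if $H/K\nleq\Phi(G/K)$. The automorphism group that $G$ induces on $H/K$ is the image of the conjugation action $G\to\operatorname{Aut}(H/K)$. A group $G$ is supersoluble if it has a series $1=N_0\le N_1\le\dots\le N_n=G$ of normal subgroups of $G$ with every $N_{i+1}/N_i$ cyclic. It is nearly nilpotent if it is supersoluble and induces on each of its non-Frattini chief factors an automorphism group of order dividing a prime (i.e. of order $1$ or a prime). It is strongly supersoluble if it is supersoluble and induces on each of its chief factors an automorphism group of square-free order. A Schunck class is a class $\mathfrak X$ of soluble groups, closed under isomorphism, such that $G\in\mathfrak X$ if and only if $G/M_G\in\mathfrak X$ for all maximal subgroups $M$ of $G$. Proposition 2.9. The class of all nearly nilpotent groups is a Schunck class, and every nearly nilpotent group is strongly supersoluble. Hence every homomorphic image of a nearly nilpotent group is nearly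 nilpotent, and $G$ is nearly nilpotent whenever $G/\Phi(G)$ is nearly nilpotent. -/

import Mathlib

universe u v

/-- `G` is supersoluble: there is a finite series `1 = N 0 ≤ N 1 ≤ ⋯ ≤ N n = G` of normal subgroups
of `G` with cyclic factors. The factor `N (i+1) / N i` is realised as the image of `N (i+1)` in
`G ⧸ N i`. -/
def IsSupersoluble (G : Type u) [Group G] : Prop :=
  ∃ (n : ℕ) (N : ℕ → Subgroup G) (_ : ∀ i, (N i).Normal),
    N 0 = ⊥ ∧ N n = ⊤ ∧
      ∀ i < n, N i ≤ N (i + 1) ∧ IsCyclic ((N (i + 1)).map (QuotientGroup.mk' (N i)))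

/-- `H / K` is a chief factor of `G`: `K < H` are normal subgroups of `G` and no normal subgroup of
`G` lies strictly between them. -/
structure IsChiefFactor {G : Type u} [Group G] (H K : Subgroup G) : Prop where
  normal_top : H.Normal
  normal_bot : K.Normal
  lt : K < H
  eq_or_eq : ∀ L : Subgroup G, L.Normal → K ≤ L → L ≤ H → L = K ∨ L = H

/-- The group of automorphisms of `H / K` (a normal subgroup of `G ⧸ K`) that `G` induces on it by
conjugation; it is isomorphic to `G / C_G(H / K)`. -/
def inducedAut {G : Type u} [Group G] (H K : Subgroup G) [H.Normal] [K.Normal] :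
    Subgroup (MulAut (H.map (QuotientGroup.mk' K))) :=
  ((MulAut.conjNormal (H := H.map (QuotientGroup.mk' K))).comp (QuotientGroup.mk' K)).range

/-- `G` is nearly nilpotent: it is supersoluble and induces on each non-Frattini chief factor
`H / K` (that is, `H / K ≰ Φ(G / K)`) an automorphism group of order dividing a prime. -/
def IsNearlyNilpotent (G : Type u) [Group G] : Prop :=
  IsSupersoluble G ∧
    ∀ (H K : Subgroup G) [H.Normal] [K.Normal], IsChiefFactor H K →
      ¬ H.map (QuotientGroup.mk' K) ≤ frattini (G ⧸ K) →
        ∃ p : ℕ, p.Prime ∧ Nat.card (inducedAut H K) ∣ p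

/-- `G` is strongly supersoluble: it is supersoluble and induces on each chief factor an
automorphism group of square-free order. -/
def IsStronglySupersoluble (G : Type u) [Group G] : Prop :=
  IsSupersoluble G ∧
    ∀ (H K : Subgroup G) [H.Normal] [K.Normal], IsChiefFactor H K →
      Squarefree (Nat.card (inducedAut H K))

/-- `X` (a property of finite groups) is a Schunck class: a class, i.e. closed under isomorphism,
of soluble groups that consists of precisely the finite groups `G` such that
`G / M_G` belongs to `X` for every maximal subgroup `M` of `G`, where `M_G` is the core of `M`. -/
structure IsSchunckClass (X : ∀ (G : Type u) [Group G] [Finite G], Prop) : Prop where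
  of_equiv : ∀ (G H : Type u) [Group G] [Finite G] [Group H] [Finite H], G ≃* H → X G → X H
  isSolvable : ∀ (G : Type u) [Group G] [Finite G], X G → Group.IsSolvable G
  mem_iff : ∀ (G : Type u) [Group G] [Finite G],
    X G ↔ ∀ M : Subgroup G, IsCoatom M → X (G ⧸ M.normalCore)

/-! Near nilpotency passes to quotients because chief factors, maximal subgroups and centralizers
all pull back along a surjection. For the converse, suppose every `G ⧸ M.normalCore` is nearly
nilpotent. The index of `M` can be read off in that supersoluble quotient, so it is prime, and
Huppert's theorem makes `G` supersoluble. If `H / K` is non-Frattini, some maximal `M ≥ K` does not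
contain `H`. Then `H ⊓ M.normalCore = K`, so `H / K` is `G`-isomorphic to a non-Frattini chief
factor of `G ⧸ M.normalCore`, where the bound is known. The Frattini statement follows, since every
such core contains Φ(G).

Strong supersolubility rests on `IsSupersoluble.mem_factorCentralizer_of_nonFrattini`: centralizing
the non-Frattini chief factors forces centralizing all of them. If `e` is the radical of |G|, every
`g ^ e` centralizes the non-Frattini factors, hence all. Each induced group is cyclic, so its order
equals its exponent, which divides the square-free `e`.

That lemma and Huppert's theorem share one engine, `commutator_eq_one_of_frattini`. It treats a
Frattini normal subgroup `N` of a normal Sylow subgroup `P`, with `N` below every nontrivial normal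
subgroup: the action on the chief factors between `N` and `P` controls the action on `N`. The
ingredients are Maschke, Schur–Zassenhaus and coprime action. -/

open scoped commutatorElement

/-! ### Chief factors, their centralizers, and transport along surjections -/

section ChiefFactors

variable {G : Type u} [Group G] {Q : Type v} [Group Q]

/-- The centralizer in `G` of the factor `H / K`. -/
def factorCentralizer (H K : Subgroup G) [H.Normal] [K.Normal] : Subgroup G :=
  ((MulAut.conjNormal (H := H.map (QuotientGroup.mk' K))).comp (QuotientGroup.mk' K)).ker

theorem card_inducedAut (H K : Subgroup G) [H.Normal] [K.Normal] :
    Nat.card (inducedAut H K) = (factorCentralizer H K).index :=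
  (Subgroup.index_ker _).symm

theorem mem_factorCentralizer {H K : Subgroup G} [H.Normal] [K.Normal] {g : G} :
    g ∈ factorCentralizer H K ↔ ∀ x ∈ H, ⁅g, x⁆ ∈ K := by
  rw [factorCentralizer, MonoidHom.mem_ker, MulEquiv.ext_iff]
  simp only [MonoidHom.comp_apply, Subtype.forall, MulAut.one_apply, Subtype.ext_iff,
    MulAut.conjNormal_apply, Subgroup.mem_map, forall_exists_index, and_imp,
    forall_apply_eq_imp_iff₂, QuotientGroup.mk'_apply]
  refine forall₂_congr fun x _ => ?_
  rw [← mul_inv_eq_one, ← QuotientGroup.eq_one_iff, commutatorElement_def]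
  rfl

theorem not_le_frattini_iff {H : Subgroup G} :
    ¬ H ≤ frattini G ↔ ∃ M : Subgroup G, IsCoatom M ∧ ¬ H ≤ M := by
  simp [frattini, Order.radical]

theorem isCoatom_comap_iff {f : G →* Q} (hf : Function.Surjective f) {M : Subgroup Q} :
    IsCoatom (M.comap f) ↔ IsCoatom M := by
  refine ⟨fun h => ⟨fun h' => h.1 (by rw [h', Subgroup.comap_top]), fun L hL => ?_⟩,
    Subgroup.isCoatom_comap_of_surjective hf⟩
  have := h.2 _ ((Subgroup.comap_lt_comap_of_surjective hf).2 hL)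
  exact Subgroup.comap_injective hf (by rw [this, Subgroup.comap_top])

theorem exists_eq_comap {f : G →* Q} {L : Subgroup G}
    (h : f.ker ≤ L) : ∃ L' : Subgroup Q, L = L'.comap f :=
  ⟨L.map f, by rw [Subgroup.comap_map_eq, sup_eq_left.2 h]⟩

theorem normal_of_normal_comap {f : G →* Q} (hf : Function.Surjective f) {L : Subgroup Q}
    (h : (L.comap f).Normal) : L.Normal := by
  have := h.map f hf
  rwa [Subgroup.map_comap_eq_self_of_surjective hf] at this

theorem isChiefFactor_comap_iff {f : G →* Q} (hf : Function.Surjective f) {H K : Subgroup Q} :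
    IsChiefFactor (H.comap f) (K.comap f) ↔ IsChiefFactor H K := by
  constructor
  · rintro ⟨h1, h2, h3, h4⟩
    refine ⟨normal_of_normal_comap hf h1, normal_of_normal_comap hf h2,
      (Subgroup.comap_lt_comap_of_surjective hf).1 h3, fun L hL hKL hLH => ?_⟩
    exact (h4 (L.comap f) (Subgroup.normal_comap f) (Subgroup.comap_mono hKL)
      (Subgroup.comap_mono hLH)).imp (fun h => Subgroup.comap_injective hf h)
      (fun h => Subgroup.comap_injective hf h)
  · rintro ⟨h1, h2, h3, h4⟩
    refine ⟨Subgroup.normal_comap f, Subgroup.normal_comap f,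
      (Subgroup.comap_lt_comap_of_surjective hf).2 h3, fun L hL hKL hLH => ?_⟩
    obtain ⟨L, rfl⟩ := exists_eq_comap (f := f) ((Subgroup.ker_le_comap _ _).trans hKL)
    exact (h4 L (normal_of_normal_comap hf hL)
      ((Subgroup.comap_le_comap_of_surjective hf).1 hKL)
      ((Subgroup.comap_le_comap_of_surjective hf).1 hLH)).imp
      (fun h => by rw [h]) (fun h => by rw [h])

theorem factorCentralizer_comap {f : G →* Q} (hf : Function.Surjective f) (H K : Subgroup Q)
    [H.Normal] [K.Normal] :
    factorCentralizer (H.comap f) (K.comap f) = (factorCentralizer H K).comap f := by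
  ext g
  simp only [mem_factorCentralizer, Subgroup.mem_comap, map_commutatorElement]
  exact ⟨fun h x hx => by obtain ⟨x, rfl⟩ := hf x; exact h x hx, fun h x hx => h _ hx⟩

/-- `H / K` is not contained in the Frattini subgroup of `G / K`. -/
theorem not_map_le_frattini_iff {H K : Subgroup G} [K.Normal] :
    ¬ H.map (QuotientGroup.mk' K) ≤ frattini (G ⧸ K) ↔
      ∃ M : Subgroup G, IsCoatom M ∧ K ≤ M ∧ ¬ H ≤ M := by
  have hs := QuotientGroup.mk'_surjective K
  rw [not_le_frattini_iff]
  constructor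
  · rintro ⟨M, hM, hHM⟩
    refine ⟨M.comap (QuotientGroup.mk' K), (isCoatom_comap_iff hs).2 hM, ?_, ?_⟩
    · simpa using Subgroup.ker_le_comap (QuotientGroup.mk' K) M
    · rwa [← Subgroup.map_le_iff_le_comap]
  · rintro ⟨M, hM, hKM, hHM⟩
    obtain ⟨M, rfl⟩ := exists_eq_comap (f := QuotientGroup.mk' K) (L := M) (by simpa using hKM)
    exact ⟨M, (isCoatom_comap_iff hs).1 hM, by rwa [Subgroup.map_le_iff_le_comap]⟩

theorem exists_isChiefFactor_above [Finite G] {K T : Subgroup G} (hK : K.Normal) (hT : T.Normal)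
    (h : K < T) : ∃ H ≤ T, IsChiefFactor H K := by
  obtain ⟨H, hHT, hH⟩ := exists_minimal_le_of_wellFoundedLT
    (fun H : Subgroup G => H.Normal ∧ K < H) T ⟨hT, h⟩
  refine ⟨H, hHT, hH.1.1, hK, hH.1.2, fun L hL hKL hLH => ?_⟩
  rcases hKL.eq_or_lt with rfl | hlt
  · exact .inl rfl
  · exact .inr (hLH.antisymm (hH.2 ⟨hL, hlt⟩ hLH))

theorem exists_isChiefFactor_below [Finite G] {K T : Subgroup G} (hK : K.Normal) (hT : T.Normal)
    (h : K < T) : ∃ L, K ≤ L ∧ IsChiefFactor T L := by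
  obtain ⟨L, hKL, hL⟩ := exists_maximal_ge_of_wellFoundedGT
    (fun L : Subgroup G => L.Normal ∧ L < T) K ⟨hK, h⟩
  refine ⟨L, hKL, hT, hL.1.1, hL.1.2, fun L' hL' h1 h2 => ?_⟩
  rcases h2.eq_or_lt with rfl | hlt
  · exact .inr rfl
  · exact .inl ((hL.2 ⟨hL', hlt⟩ h1).antisymm h1)

/-- If the normal subgroup `R` meets `H` in `K`, then `HR / R` is a chief factor together with
`H / K`. -/
theorem IsChiefFactor.sup {H K R : Subgroup G} (h : IsChiefFactor H K) (hR : R.Normal)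
    (hHR : H ⊓ R = K) : IsChiefFactor (H ⊔ R) R := by
  have := h.normal_top
  refine ⟨inferInstance, hR, lt_of_le_of_ne le_sup_right fun he => ?_, fun L hL h1 h2 => ?_⟩
  · have : H ≤ R := by rw [he]; exact le_sup_left
    exact h.lt.ne (by rw [← hHR, inf_eq_left.2 this])
  · have hmod : L = R ⊔ H ⊓ L := by
      refine le_antisymm (fun x hx => ?_) (sup_le h1 inf_le_right)
      obtain ⟨y, hy, r, hr, rfl⟩ := Subgroup.mem_sup_of_normal_right.1 (h2 hx)
      have hyL : y ∈ L := by simpa using L.mul_mem hx (L.inv_mem (h1 hr))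
      exact mul_mem (Subgroup.mem_sup_right ⟨hy, hyL⟩) (Subgroup.mem_sup_left hr)
    rcases h.eq_or_eq (H ⊓ L) inferInstance (hHR ▸ inf_le_inf_left H h1) inf_le_left with he | he
    · left
      rw [hmod, he, ← hHR, sup_eq_left]
      exact inf_le_right
    · right
      rw [hmod, he, sup_comm]

/-- The natural map from H/K to HR/R is an isomorphism of `G`-groups. -/
theorem factorCentralizer_sup {H K R : Subgroup G} [H.Normal] [K.Normal] [R.Normal]
    (hHR : H ⊓ R = K) : factorCentralizer (H ⊔ R) R = factorCentralizer H K := by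
  ext g
  simp only [mem_factorCentralizer]
  constructor
  · intro h x hx
    rw [← hHR]
    refine ⟨?_, h x (Subgroup.mem_sup_left hx)⟩
    rw [commutatorElement_def]
    exact H.mul_mem (‹H.Normal›.conj_mem x hx g) (H.inv_mem hx)
  · intro h x hx
    obtain ⟨y, hy, r, hr, rfl⟩ := Subgroup.mem_sup_of_normal_right.1 hx
    have h1 : ⁅g, y⁆ ∈ R := (hHR ▸ h y hy : ⁅g, y⁆ ∈ H ⊓ R).2
    have h2 : ⁅g, y * r⁆ = ⁅g, y⁆ * (y * (g * r * g⁻¹ * r⁻¹) * y⁻¹) := by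
      simp only [commutatorElement_def]; group
    rw [h2]
    exact R.mul_mem h1 (‹R.Normal›.conj_mem _
      (R.mul_mem (‹R.Normal›.conj_mem r hr g) (R.inv_mem hr)) y)

theorem isNearlyNilpotent_iff : IsNearlyNilpotent G ↔ IsSupersoluble G ∧
    ∀ (H K : Subgroup G) [H.Normal] [K.Normal], IsChiefFactor H K →
      ∀ M : Subgroup G, IsCoatom M → K ≤ M → ¬ H ≤ M →
        ∃ p : ℕ, p.Prime ∧ (factorCentralizer H K).index ∣ p := by
  simp only [IsNearlyNilpotent, not_map_le_frattini_iff, card_inducedAut]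
  exact and_congr_right fun _ => ⟨fun h H K _ _ hc M h1 h2 h3 => h H K hc ⟨M, h1, h2, h3⟩,
    fun h H K _ _ hc ⟨M, h1, h2, h3⟩ => h H K hc M h1 h2 h3⟩

end ChiefFactors

/-! ### Supersoluble groups: closure properties, prime chief factors, prime indices -/

section Supersoluble

variable {G : Type u} [Group G] {Q : Type v} [Group Q]

/-- An element-level criterion, which avoids comparing quotients by different subgroups. -/
theorem isCyclic_map_mk'_iff {H K : Subgroup G} [K.Normal] :
    IsCyclic (H.map (QuotientGroup.mk' K)) ↔ ∃ c ∈ H, ∀ x ∈ H, ∃ k : ℤ, (c ^ k)⁻¹ * x ∈ K := by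
  rw [Subgroup.isCyclic_iff_exists_zpowers_eq_top]
  constructor
  · rintro ⟨g, hg⟩
    obtain ⟨c, hc, rfl⟩ : g ∈ H.map (QuotientGroup.mk' K) := hg ▸ Subgroup.mem_zpowers g
    refine ⟨c, hc, fun x hx => ?_⟩
    obtain ⟨k, hk⟩ := Subgroup.mem_zpowers_iff.1
      (hg.symm ▸ Subgroup.mem_map_of_mem _ hx : QuotientGroup.mk' K x ∈ _)
    exact ⟨k, QuotientGroup.eq.1 (by simpa using hk)⟩
  · rintro ⟨c, hc, h⟩
    refine ⟨QuotientGroup.mk' K c, le_antisymm ?_ ?_⟩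
    · rw [Subgroup.zpowers_le]
      exact Subgroup.mem_map_of_mem _ hc
    · rintro _ ⟨x, hx, rfl⟩
      obtain ⟨k, hk⟩ := h x hx
      exact Subgroup.mem_zpowers_iff.2 ⟨k, by simpa using QuotientGroup.eq.2 hk⟩

theorem isSupersoluble_of_subsingleton [Subsingleton G] : IsSupersoluble G :=
  ⟨0, fun _ => ⊥, fun _ => inferInstance, rfl, Subsingleton.elim _ _, by simp⟩

theorem IsSupersoluble.of_surjective (h : IsSupersoluble G) {f : G →* Q}
    (hf : Function.Surjective f) : IsSupersoluble Q := by
  obtain ⟨n, N, hN, h0, hn, h⟩ := h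
  have hN' := fun i => (hN i).map f hf
  refine ⟨n, fun i => (N i).map f, hN', by simp [h0],
    by simp only [hn]; exact Subgroup.map_top_of_surjective f hf,
    fun i hi => ⟨Subgroup.map_mono (h i hi).1, ?_⟩⟩
  obtain ⟨c, hc, hcx⟩ := isCyclic_map_mk'_iff.1 (h i hi).2
  refine isCyclic_map_mk'_iff.2 ⟨f c, Subgroup.mem_map_of_mem _ hc, ?_⟩
  rintro _ ⟨x, hx, rfl⟩
  obtain ⟨k, hk⟩ := hcx x hx
  exact ⟨k, by simpa using Subgroup.mem_map_of_mem f hk⟩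

theorem IsSupersoluble.of_quotient {N : Subgroup G} [N.Normal] (hN : IsCyclic N)
    (h : IsSupersoluble (G ⧸ N)) : IsSupersoluble G := by
  obtain ⟨n, M, hM, h0, hn, h⟩ := h
  -- The pulled-back series is shifted by one to make room for `⊥`; the new bottom factor is `N`
  -- itself.
  let T : ℕ → Subgroup G
    | 0 => ⊥
    | i + 1 => (M i).comap (QuotientGroup.mk' N)
  have hT : ∀ i, (T i).Normal := fun i => by
    cases i with
    | zero => exact (inferInstance : (⊥ : Subgroup G).Normal)
    | succ i => exact Subgroup.normal_comap _
  refine ⟨n + 1, T, hT, rfl, by simp [T, hn], fun i hi => ?_⟩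
  cases i with
  | zero =>
    refine ⟨bot_le, ?_⟩
    refine (@isCyclic_map_mk'_iff _ _ (T 1) (T 0) (hT 0)).2 ?_
    have h1 : T 1 = N := by simp [T, h0]
    obtain ⟨g, hg⟩ := hN.exists_generator
    rw [h1]
    refine ⟨g, g.2, fun x hx => ?_⟩
    obtain ⟨k, hk⟩ := Subgroup.mem_zpowers_iff.1 (hg ⟨x, hx⟩)
    refine ⟨k, ?_⟩
    have : (g : G) ^ k = x := by simpa using congrArg Subtype.val hk
    simp [T, this]
  | succ i =>
    obtain ⟨h1, h2⟩ := h i (by omega)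
    refine ⟨Subgroup.comap_mono h1, isCyclic_map_mk'_iff.2 ?_⟩
    obtain ⟨c, hc, hcx⟩ := isCyclic_map_mk'_iff.1 h2
    obtain ⟨c, rfl⟩ := QuotientGroup.mk'_surjective N c
    refine ⟨c, hc, fun x hx => ?_⟩
    obtain ⟨k, hk⟩ := hcx (QuotientGroup.mk' N x) hx
    exact ⟨k, by simpa [T] using hk⟩

theorem IsChiefFactor.isCyclic {H K : Subgroup G} [K.Normal] (hc : IsChiefFactor H K)
    (hG : IsSupersoluble G) : IsCyclic (H.map (QuotientGroup.mk' K)) := by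
  obtain ⟨n, N, hN, h0, hn, h⟩ := hG
  have hH := hc.normal_top
  have key : ∀ i, N i ⊓ H ⊔ K = K ∨ N i ⊓ H ⊔ K = H := fun i =>
    hc.eq_or_eq _ inferInstance le_sup_right (sup_le inf_le_right hc.lt.le)
  have hex : ∃ i, N i ⊓ H ⊔ K = H := ⟨n, by rw [hn, top_inf_eq, sup_eq_left.2 hc.lt.le]⟩
  classical
  -- At the least `i` where the series covers `H / K`, the previous term meets `H` inside `K`, so `H
  -- / K` is a quotient of a section of one cyclic factor.
  obtain ⟨i, hi, hmin⟩ : ∃ i, N i ⊓ H ⊔ K = H ∧ ∀ j < i, N j ⊓ H ⊔ K ≠ H :=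
    ⟨Nat.find hex, Nat.find_spec hex, fun j hj => Nat.find_min hex hj⟩
  have hin : i ≤ n := by
    by_contra! hlt
    exact hmin n hlt (by rw [hn, top_inf_eq, sup_eq_left.2 hc.lt.le])
  cases i with
  | zero =>
    rw [h0, bot_inf_eq, bot_sup_eq] at hi
    exact absurd hi hc.lt.ne
  | succ i =>
    have hK : N i ⊓ H ≤ K := by
      rw [← (key i).resolve_right (hmin i (by omega))]
      exact le_sup_left
    obtain ⟨h1, h2⟩ := h i (by omega)
    have h3 : IsCyclic ((N (i + 1) ⊓ H).map (QuotientGroup.mk' (N i))) :=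
      isCyclic_of_injective (Subgroup.inclusion (Subgroup.map_mono inf_le_left))
        (Subgroup.inclusion_injective _)
    obtain ⟨c, hc, hcx⟩ := isCyclic_map_mk'_iff.1 h3
    refine isCyclic_map_mk'_iff.2 ⟨c, hc.2, fun x hx => ?_⟩
    rw [← hi] at hx
    obtain ⟨y, hy, k, hk, rfl⟩ := Subgroup.mem_sup_of_normal_right.1 hx
    obtain ⟨m, hm⟩ := hcx y hy
    refine ⟨m, ?_⟩
    rw [← mul_assoc]
    exact K.mul_mem (hK ⟨hm, H.mul_mem (H.inv_mem (H.zpow_mem hc.2 m)) hy.2⟩) hk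

theorem isChiefFactor_map_mk'_bot {H K : Subgroup G} [K.Normal] (hc : IsChiefFactor H K) :
    IsChiefFactor (H.map (QuotientGroup.mk' K)) ⊥ := by
  rw [← isChiefFactor_comap_iff (QuotientGroup.mk'_surjective K)]
  rw [Subgroup.comap_map_eq, QuotientGroup.ker_mk', sup_eq_left.2 hc.lt.le,
    MonoidHom.comap_bot, QuotientGroup.ker_mk']
  exact hc

/-- Subgroups of a cyclic group are characteristic, hence here normal in `G`; minimality makes `H`
simple. -/
theorem prime_card_of_isCyclic [Finite G] {H : Subgroup G} (hc : IsChiefFactor H ⊥)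
    (h : IsCyclic H) : (Nat.card H).Prime := by
  have hH := hc.normal_top
  have : IsSimpleGroup H := by
    have hnt : Nontrivial H := (Subgroup.nontrivial_iff_ne_bot H).2 hc.lt.ne'
    refine ⟨fun L _ => ?_⟩
    have hL : (L.map H.subtype).Normal := by
      refine ⟨?_⟩
      rintro _ ⟨x, hx, rfl⟩ g
      obtain ⟨m, hm⟩ := MonoidHom.map_cyclic (MulAut.conjNormal (H := H) g).toMonoidHom
      refine ⟨x ^ m, L.zpow_mem hx m, ?_⟩
      rw [← hm x]
      simp
    rcases hc.eq_or_eq _ hL bot_le (Subgroup.map_subtype_le L) with h | h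
    · left
      rwa [Subgroup.map_eq_bot_iff_of_injective _ H.subtype_injective] at h
    · right
      rw [eq_top_iff]
      intro x _
      have : (x : G) ∈ L.map H.subtype := by rw [h]; exact x.2
      simpa using this
  let _ : CommGroup H := IsCyclic.commGroup
  exact IsSimpleGroup.prime_card

theorem IsChiefFactor.prime_card [Finite G] {H K : Subgroup G} [K.Normal]
    (hc : IsChiefFactor H K) (hG : IsSupersoluble G) :
    (Nat.card (H.map (QuotientGroup.mk' K))).Prime :=
  prime_card_of_isCyclic (isChiefFactor_map_mk'_bot hc) (hc.isCyclic hG)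

theorem card_map_mk' {H K : Subgroup G} [K.Normal] :
    Nat.card (H.map (QuotientGroup.mk' K)) = K.relIndex H := by
  have := Subgroup.relIndex_ker H (QuotientGroup.mk' K)
  rw [← this, QuotientGroup.ker_mk']

theorem index_eq_relIndex_of_sup_eq_top [Finite G] {M H : Subgroup G} [H.Normal]
    (htop : M ⊔ H = ⊤) : M.index = M.relIndex H := by
  have h3 := Subgroup.relIndex_mul_index (inf_le_right : M ⊓ H ≤ H)
  have h4 := Subgroup.relIndex_mul_index (inf_le_left : M ⊓ H ≤ M)
  have h5 := Subgroup.relIndex_sup_right M H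
  rw [htop, Subgroup.relIndex_top_right] at h5
  rw [Subgroup.inf_relIndex_right] at h3
  rw [Subgroup.inf_relIndex_left, ← h5, mul_comm, ← h3] at h4
  exact Nat.eq_of_mul_eq_mul_right (Nat.pos_of_ne_zero H.index_ne_zero_of_finite) h4

/-- A chief factor `H / M.normalCore` has prime order and `H` supplements `M`, so the index of `M`
divides that prime. -/
theorem IsSupersoluble.prime_index [Finite G] (hG : IsSupersoluble G) {M : Subgroup G}
    (hM : IsCoatom M) : M.index.Prime := by
  have hR : M.normalCore ≠ ⊤ := fun h => hM.1 (top_le_iff.1 (h ▸ M.normalCore_le))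
  obtain ⟨H, -, hc⟩ := exists_isChiefFactor_above (K := M.normalCore) inferInstance
    (inferInstance : (⊤ : Subgroup G).Normal) (lt_top_iff_ne_top.2 hR)
  have hH := hc.normal_top
  have hHM : ¬ H ≤ M := fun h => hc.lt.not_ge (Subgroup.normal_le_normalCore.2 h)
  have htop : M ⊔ H = ⊤ := hM.2 _ (left_lt_sup.2 hHM)
  have hp := hc.prime_card hG
  rw [card_map_mk'] at hp
  have hdvd : M.relIndex H ∣ M.normalCore.relIndex H :=
    Subgroup.relIndex_dvd_of_le_left H M.normalCore_le
  have hind := index_eq_relIndex_of_sup_eq_top htop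
  rcases (Nat.dvd_prime hp).1 hdvd with h | h
  · rw [← hind, Subgroup.index_eq_one] at h
    exact absurd h hM.1
  · rw [hind, h]
    exact hp

theorem card_quotient_lt [Finite G] {L : Subgroup G} (h : L ≠ ⊥) :
    Nat.card (G ⧸ L) < Nat.card G := by
  rw [← Subgroup.index_eq_card, ← L.card_mul_index]
  exact lt_mul_of_one_lt_left (Nat.pos_of_ne_zero L.index_ne_zero_of_finite)
    (L.one_lt_card_iff_ne_bot.2 h)

theorem IsSupersoluble.isSolvable [Finite G] (hG : IsSupersoluble G) : Group.IsSolvable G := by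
  induction hn : Nat.card G using Nat.strong_induction_on generalizing G with
  | _ n ih =>
    rcases subsingleton_or_nontrivial G with h | h
    · infer_instance
    · obtain ⟨H, -, hc⟩ := exists_isChiefFactor_above (K := (⊥ : Subgroup G)) inferInstance
        (inferInstance : (⊤ : Subgroup G).Normal) bot_lt_top
      have hH := hc.normal_top
      have := ih _ (hn ▸ card_quotient_lt hc.lt.ne') (hG.of_surjective (QuotientGroup.mk'_surjective H)) rfl
      have hp := hc.prime_card hG
      rw [card_map_mk', Subgroup.relIndex_bot_left] at hp
      have := Fact.mk hp
      have : IsCyclic H := isCyclic_of_prime_card rfl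
      let _ : CommGroup H := IsCyclic.commGroup
      exact Group.isSolvable_of_ker_le_range H.subtype (QuotientGroup.mk' H) (by simp)

/-- The automorphism group of a group of order `p` is the unit group of ℤ/p: abelian of exponent
dividing `p - 1`. -/
theorem factorCentralizer_of_prime [Finite G] {H K : Subgroup G} [H.Normal] [K.Normal] {p : ℕ}
    [hp : Fact p.Prime] (h : K.relIndex H = p) (a b : G) :
    ⁅a, b⁆ ∈ factorCentralizer H K ∧ a ^ (p - 1) ∈ factorCentralizer H K := by
  rw [← card_map_mk'] at h
  have : IsCyclic (H.map (QuotientGroup.mk' K)) := isCyclic_of_prime_card h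
  let e := IsCyclic.mulAutMulEquiv (H.map (QuotientGroup.mk' K))
  rw [h] at e
  constructor
  · rw [factorCentralizer, MonoidHom.mem_ker, map_commutatorElement, ← e.map_eq_one_iff,
      map_commutatorElement, commutatorElement_eq_one_iff_mul_comm, mul_comm]
  · rw [factorCentralizer, MonoidHom.mem_ker, map_pow, ← e.map_eq_one_iff, map_pow,
      ZMod.units_pow_card_sub_one_eq_one]

end Supersoluble

/-! ### Elementary abelian groups, characteristic pieces of a normal `p`-subgroup, Maschke -/

section NormalSylow

variable {G : Type u} [Group G]

theorem eq_one_of_pow_coprime {x : G} {m n : ℕ} (hm : x ^ m = 1) (hn : x ^ n = 1)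
    (h : m.Coprime n) : x = 1 := by
  rw [← orderOf_eq_one_iff, ← Nat.dvd_one, ← h]
  exact Nat.dvd_gcd (orderOf_dvd_of_pow_eq_one hm) (orderOf_dvd_of_pow_eq_one hn)

theorem mem_of_pow_coprime {C : Subgroup G} {x : G} {m n : ℕ} (hm : x ^ m ∈ C) (hn : x ^ n ∈ C)
    (h : m.Coprime n) : x ∈ C := by
  obtain ⟨u, v, huv⟩ : ∃ u v : ℤ, (m : ℤ) * u + n * v = 1 :=
    ⟨_, _, by rw [← Nat.gcd_eq_gcd_ab, h]; rfl⟩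
  rw [← zpow_one x, ← huv, zpow_add, zpow_mul, zpow_mul, zpow_natCast, zpow_natCast]
  exact C.mul_mem (C.zpow_mem hm u) (C.zpow_mem hn v)

theorem exists_linear_retraction {k V : Type*} [Field k] [AddCommGroup V] [Module k V]
    (W : Submodule k V) : ∃ f : V →ₗ[k] V, (∀ v, f v ∈ W) ∧ ∀ w ∈ W, f w = w := by
  obtain ⟨g, hg⟩ := W.subtype.exists_leftInverse_of_injective W.ker_subtype
  exact ⟨W.subtype ∘ₗ g, fun v => (g v).2,
    fun w hw => congrArg Subtype.val (LinearMap.congr_fun hg ⟨w, hw⟩)⟩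

theorem exists_retraction {A : Type u} [CommGroup A] {p : ℕ} [Fact p.Prime]
    (h : ∀ a : A, a ^ p = 1) (B : Subgroup A) :
    ∃ π : A →* A, (∀ a, π a ∈ B) ∧ ∀ b ∈ B, π b = b := by
  let _ : Module (ZMod p) (Additive A) := AddCommGroup.zmodModule h
  obtain ⟨f, hf, hfB⟩ := exists_linear_retraction
    (AddSubgroup.toZModSubmodule p B.toAddSubgroup : Submodule (ZMod p) (Additive A))
  exact ⟨MonoidHom.toAdditive.symm f.toAddMonoidHom, hf, hfB⟩

theorem closure_normal_of_conj {S : Set G} (h : ∀ g : G, ∀ x ∈ S, g * x * g⁻¹ ∈ S) :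
    (Subgroup.closure S).Normal := by
  refine ⟨fun n hn g => ?_⟩
  have : Subgroup.closure S ≤ (Subgroup.closure S).comap (MulAut.conj g).toMonoidHom := by
    rw [Subgroup.closure_le]
    exact fun x hx => Subgroup.subset_closure (h g x hx)
  exact this hn

/-- The subgroup generated by the `p`-th powers and the commutators of elements of `P`. -/
def powersCommutators (p : ℕ) (P : Subgroup G) : Subgroup G :=
  Subgroup.closure ({g | ∃ x ∈ P, x ^ p = g} ∪ {g | ∃ x ∈ P, ∃ y ∈ P, ⁅x, y⁆ = g})

instance powersCommutators_normal (p : ℕ) (P : Subgroup G) [hP : P.Normal] :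
    (powersCommutators p P).Normal := by
  refine closure_normal_of_conj fun g z hz => ?_
  rcases hz with ⟨x, hx, rfl⟩ | ⟨x, hx, y, hy, rfl⟩
  · exact .inl ⟨g * x * g⁻¹, hP.conj_mem x hx g, conj_pow⟩
  · refine .inr ⟨g * x * g⁻¹, hP.conj_mem x hx g, g * y * g⁻¹, hP.conj_mem y hy g, ?_⟩
    simp only [commutatorElement_def]
    group

/-- The elements of order dividing `p` in the centre of `P`. -/
def centralTorsion (p : ℕ) (P : Subgroup G) : Subgroup G where
  carrier := {x | x ∈ P ∧ (∀ y ∈ P, x * y = y * x) ∧ x ^ p = 1}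
  one_mem' := ⟨P.one_mem, by simp, by simp⟩
  mul_mem' := by
    rintro a b ⟨ha, ha', hap⟩ ⟨hb, hb', hbp⟩
    refine ⟨P.mul_mem ha hb, fun y hy => ?_, ?_⟩
    · rw [mul_assoc, hb' y hy, ← mul_assoc, ha' y hy, mul_assoc]
    · rw [(show Commute a b from ha' b hb).mul_pow, hap, hbp, one_mul]
  inv_mem' := by
    rintro a ⟨ha, ha', hap⟩
    refine ⟨P.inv_mem ha, fun y hy => ?_, by rw [inv_pow, hap, inv_one]⟩
    exact (show Commute a y from ha' y hy).inv_left

instance centralTorsion_normal (p : ℕ) (P : Subgroup G) [hP : P.Normal] :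
    (centralTorsion p P).Normal := by
  refine ⟨fun x hx g => ⟨hP.conj_mem x hx.1 g, fun y hy => ?_, ?_⟩⟩
  · have h := hx.2.1 (g⁻¹ * y * g) (by simpa using hP.conj_mem y hy g⁻¹)
    calc g * x * g⁻¹ * y = g * (x * (g⁻¹ * y * g)) * g⁻¹ := by group
      _ = y * (g * x * g⁻¹) := by rw [h]; group
  · rw [conj_pow, hx.2.2]
    simp

theorem centralTorsion_ne_bot [Finite G] {p : ℕ} [Fact p.Prime] {P : Subgroup G}
    (hP : IsPGroup p P) (hne : P ≠ ⊥) : centralTorsion p P ≠ ⊥ := by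
  have : Nontrivial P := (Subgroup.nontrivial_iff_ne_bot P).2 hne
  have hc := hP.center_nontrivial
  obtain ⟨n, hn, hcard⟩ := (hP.to_subgroup (Subgroup.center P)).nontrivial_iff_card.1 hc
  obtain ⟨z, hz⟩ := exists_prime_orderOf_dvd_card' (G := Subgroup.center P) p
    (hcard ▸ dvd_pow_self p hn.ne')
  intro h
  have hmem : ((z : P) : G) ∈ centralTorsion p P := by
    refine ⟨(z : P).2, fun y hy => ?_, ?_⟩
    · have := Subgroup.mem_center_iff.1 z.2 ⟨y, hy⟩
      exact (congrArg Subtype.val this).symm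
    · have := pow_orderOf_eq_one z
      rw [hz] at this
      simpa using congrArg (fun w : Subgroup.center P => ((w : P) : G)) this
  rw [h, Subgroup.mem_bot] at hmem
  have hz1 : z = 1 := by
    apply Subtype.ext; apply Subtype.ext; exact hmem
  rw [hz1, orderOf_one] at hz
  exact (Fact.out : p.Prime).one_lt.ne hz

/-- Maschke's theorem for an elementary abelian normal `p`-subgroup `P` supplemented by a subgroup
`K` of order prime to `p`. -/
theorem exists_normal_complement [Finite G] {p : ℕ} [hp : Fact p.Prime] {P N K : Subgroup G}
    [hPn : P.Normal] [hNn : N.Normal] (hNP : N ≤ P)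
    (hcomm : ∀ x ∈ P, ∀ y ∈ P, x * y = y * x) (hpow : ∀ x ∈ P, x ^ p = 1)
    (hPK : P ⊔ K = ⊤) (hK : ¬ p ∣ Nat.card K) :
    ∃ L : Subgroup G, L.Normal ∧ L ⊓ N = ⊥ ∧ L ⊔ N = P := by
  let _ : CommGroup P := { mul_comm := fun a b => Subtype.ext (hcomm a a.2 b b.2) }
  obtain ⟨π, hπ, hπN⟩ := exists_retraction (A := P) (p := p)
    (fun a => Subtype.ext (by simpa using hpow a a.2)) (N.subgroupOf P)
  let c : G →* MulAut P := MulAut.conjNormal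
  have := Fintype.ofFinite K
  -- Maschke averaging without the division by |K|: on `N` this is the |K|-th power map, invertible
  -- because `p` does not divide |K|.
  let τ : P →* P := ∏ k : K, (c k).toMonoidHom.comp (π.comp (c (k : G)⁻¹).toMonoidHom)
  have hτ : ∀ x, τ x = ∏ k : K, c k (π (c (k : G)⁻¹ x)) := fun x => by
    simp [τ, MonoidHom.finsetProd_apply]
  have hcN : ∀ (g : G) (x : P), x ∈ N.subgroupOf P → c g x ∈ N.subgroupOf P := by
    intro g x hx
    simp only [Subgroup.mem_subgroupOf, c, MulAut.conjNormal_apply] at hx ⊢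
    exact hNn.conj_mem _ hx g
  have hτmem : ∀ x, τ x ∈ N.subgroupOf P := fun x => by
    rw [hτ]
    exact Subgroup.prod_mem _ fun k _ => hcN _ _ (hπ _)
  have hτN : ∀ x ∈ N.subgroupOf P, τ x = x ^ Nat.card K := by
    intro x hx
    rw [hτ, Finset.prod_congr rfl (g := fun _ => x), Finset.prod_const, Finset.card_univ,
      Nat.card_eq_fintype_card]
    intro k _
    rw [hπN _ (hcN _ _ hx), map_inv]
    exact (c k).apply_symm_apply x
  have hτK : ∀ (k : K) (x : P), τ (c k x) = c k (τ x) := by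
    intro k x
    rw [hτ, hτ, map_prod]
    refine (Fintype.prod_equiv (Equiv.mulLeft k) _ _ fun l => ?_).symm
    simp [map_mul]
  -- The abelian group `P` acts trivially on itself, so invariance under `K` gives invariance under
  -- `G = PK`.
  have hLK : ∀ g : G, ∀ x ∈ τ.ker, c g x ∈ τ.ker := by
    intro g x hx
    have hg : g ∈ P ⊔ K := hPK ▸ Subgroup.mem_top g
    obtain ⟨y, hy, k, hk, rfl⟩ := Subgroup.mem_sup_of_normal_left.1 hg
    have h1 : ∀ z, c y z = z := fun z => Subtype.ext <| by
      simp only [c, MulAut.conjNormal_apply]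
      rw [hcomm y hy z z.2, mul_inv_cancel_right]
    rw [map_mul, MulAut.mul_apply, h1, MonoidHom.mem_ker, hτK ⟨k, hk⟩, MonoidHom.mem_ker.1 hx,
      map_one]
  have hcop : p.Coprime (Nat.card K) := (Nat.Prime.coprime_iff_not_dvd hp.out).2 hK
  refine ⟨τ.ker.map P.subtype, ⟨?_⟩, ?_, ?_⟩
  · rintro _ ⟨x, hx, rfl⟩ g
    exact ⟨c g x, hLK g x hx, by simp [c]⟩
  · rw [eq_bot_iff]
    rintro _ ⟨⟨x, hx, rfl⟩, hxN⟩
    have h1 : x ^ Nat.card K = 1 := by rw [← hτN x hxN]; exact hx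
    have h2 : x ^ p = 1 := Subtype.ext (by simpa using hpow x x.2)
    simp [eq_one_of_pow_coprime h2 h1 hcop]
  · refine le_antisymm (sup_le (Subgroup.map_subtype_le _) hNP) fun x hx => ?_
    obtain ⟨u, v, huv⟩ : ∃ u v : ℤ, (p : ℤ) * u + Nat.card K * v = 1 :=
      ⟨_, _, by rw [← Nat.gcd_eq_gcd_ab, hcop]; rfl⟩
    let X : P := ⟨x, hx⟩
    -- The exponent `v` inverts |K| modulo `p`, so `n` is the component of `X` in `N`.
    let n : P := τ X ^ v
    have hn : n ∈ N.subgroupOf P := Subgroup.zpow_mem _ (hτmem X) v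
    have hpP : ∀ y : P, y ^ (p : ℤ) = 1 := fun y =>
      Subtype.ext (by simpa using hpow y y.2)
    have hτn : τ n = τ X := by
      rw [hτN n hn, ← zpow_natCast, ← zpow_mul]
      conv_rhs => rw [← zpow_one (τ X), ← huv, zpow_add, zpow_mul, hpP, one_zpow, one_mul]
      rw [mul_comm]
    have hker : X * n⁻¹ ∈ τ.ker := by
      rw [MonoidHom.mem_ker, map_mul, map_inv, hτn, mul_inv_cancel]
    have : x = (X * n⁻¹ : P) * (n : P) := by simp [X]
    rw [this]
    exact mul_mem (Subgroup.mem_sup_left ⟨_, hker, rfl⟩) (Subgroup.mem_sup_right hn)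

end NormalSylow

/-! ### Action on a Frattini normal subgroup of a normal Sylow subgroup -/

section StableSeries

variable {G : Type u} [Group G]

/-- If `P` is an elementary abelian normal Sylow subgroup and `N ≤ P` is contained in every
nontrivial normal subgroup, then `N` is not contained in the Frattini subgroup. -/
theorem not_le_frattini_of_elementary [Finite G] {p : ℕ} [hp : Fact p.Prime] {P N : Subgroup G}
    [P.Normal] [N.Normal] (hP : IsPGroup p P) (hidx : ¬ p ∣ P.index) (hNP : N ≤ P) (hN : N ≠ ⊥)
    (huniq : ∀ L : Subgroup G, L.Normal → L ≠ ⊥ → N ≤ L)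
    (hcomm : ∀ x ∈ P, ∀ y ∈ P, x * y = y * x) (hpow : ∀ x ∈ P, x ^ p = 1) :
    ¬ N ≤ frattini G := by
  intro hΦ
  obtain ⟨n, hn⟩ := IsPGroup.iff_card.1 hP
  have hcop : (Nat.card P).Coprime P.index := by
    rw [hn]
    exact Nat.Coprime.pow_left n ((Nat.Prime.coprime_iff_not_dvd hp.out).2 hidx)
  -- Schur–Zassenhaus. The Maschke complement of `N` in `P` will be trivial, so `P = N` and `K`
  -- complements `N`, which a Frattini subgroup forbids.
  obtain ⟨K, hK⟩ := Subgroup.exists_right_complement'_of_coprime hcop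
  have hcardK : Nat.card K = P.index := hK.symm.index_eq_card.symm
  obtain ⟨L, hL, hLN, hLP⟩ := exists_normal_complement hNP hcomm hpow hK.sup_eq_top
    (hcardK ▸ hidx)
  have hL1 : L = ⊥ := by
    by_contra hne
    exact hN (by rw [← hLN, inf_eq_right.2 (huniq L hL hne)])
  rw [hL1, bot_sup_eq] at hLP
  have hKtop : K ≠ ⊤ := by
    rintro rfl
    rw [Subgroup.card_top] at hcardK
    have h1 := P.card_mul_index
    rw [← hcardK] at h1
    have h2 : Nat.card P = 1 := by
      exact Nat.eq_of_mul_eq_mul_right Nat.card_pos (by rw [h1, one_mul])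
    exact hN (hLP.trans (Subgroup.card_eq_one.1 h2))
  obtain ⟨M, hM, hKM⟩ := (eq_top_or_exists_le_coatom K).resolve_left hKtop
  refine hM.1 (top_le_iff.1 ?_)
  rw [← hK.sup_eq_top, ← hLP]
  exact sup_le (hΦ.trans (frattini_le_coatom hM)) hKM

/-- If `powersCommutators p P` were trivial, `P` would be elementary abelian and `N` could not be
Frattini. -/
theorem le_powersCommutators [Finite G] {p : ℕ} [hp : Fact p.Prime] {P N : Subgroup G}
    [P.Normal] [N.Normal] (hP : IsPGroup p P) (hidx : ¬ p ∣ P.index) (hNP : N ≤ P) (hN : N ≠ ⊥)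
    (huniq : ∀ L : Subgroup G, L.Normal → L ≠ ⊥ → N ≤ L) (hΦ : N ≤ frattini G) :
    N ≤ powersCommutators p P := by
  refine huniq _ inferInstance fun h => ?_
  refine not_le_frattini_of_elementary hP hidx hNP hN huniq (fun x hx y hy => ?_)
    (fun x hx => ?_) hΦ
  · have : ⁅x, y⁆ ∈ powersCommutators p P :=
      Subgroup.subset_closure (.inr ⟨x, hx, y, hy, rfl⟩)
    rwa [h, Subgroup.mem_bot, commutatorElement_eq_one_iff_mul_comm] at this
  · have : x ^ p ∈ powersCommutators p P := Subgroup.subset_closure (.inl ⟨x, hx, rfl⟩)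
    rwa [h, Subgroup.mem_bot] at this

/-- If `b` centralizes `P` modulo a subgroup of its central `p`-torsion, then it centralizes the
`p`-th powers and the commutators of elements of `P`. -/
theorem powersCommutators_le_centralizer {p : ℕ} {P N : Subgroup G} [P.Normal]
    (hN : N ≤ centralTorsion p P) {b : G} (hb : ∀ x ∈ P, ⁅b, x⁆ ∈ N) :
    powersCommutators p P ≤ Subgroup.centralizer {b} := by
  have key : ∀ x ∈ P, ∃ n ∈ centralTorsion p P, b * x * b⁻¹ = n * x := fun x hx =>
    ⟨⁅b, x⁆, hN (hb x hx), by rw [commutatorElement_def, inv_mul_cancel_right]⟩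
  have hc : ∀ z, b * z * b⁻¹ = z → z ∈ Subgroup.centralizer {b} := fun z hz => by
    rw [Subgroup.mem_centralizer_singleton_iff]
    rw [mul_inv_eq_iff_eq_mul] at hz
    exact hz.symm
  rw [powersCommutators, Subgroup.closure_le]
  rintro z (⟨x, hx, rfl⟩ | ⟨x, hx, y, hy, rfl⟩)
  · obtain ⟨n, hn, h⟩ := key x hx
    refine hc _ ?_
    rw [← conj_pow, h, (show Commute n x from hn.2.1 x hx).mul_pow, hn.2.2, one_mul]
  · obtain ⟨n, hn, h⟩ := key x hx
    obtain ⟨m, hm, h'⟩ := key y hy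
    refine hc _ ?_
    have e : b * ⁅x, y⁆ * b⁻¹ = ⁅b * x * b⁻¹, b * y * b⁻¹⁆ := by
      simp only [commutatorElement_def]; group
    have hnx : Commute n x := hn.2.1 x hx
    have hny : Commute n y := hn.2.1 y hy
    have hnm : Commute n m := hn.2.1 m hm.1
    have hmx : Commute m x := hm.2.1 x hx
    have hmy : Commute m y := hm.2.1 y hy
    -- The factors `n` and `m` are central in `P`, so they drop out of the commutator.
    have h1 : ⁅n * x, m * y⁆ = n * m * n⁻¹ * m⁻¹ * ⁅x, y⁆ := by
      have a1 : n * x * (m * y) = n * m * (x * y) := by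
        rw [mul_assoc, ← mul_assoc x, ← hmx.eq]; group
      have a2 : m * y * (n * x) = m * n * (y * x) := by
        rw [mul_assoc, ← mul_assoc y, ← hny.eq]; group
      have a4 : Commute (m * n) ((x * y) * (y * x)⁻¹) := by
        refine Commute.mul_right ?_ (Commute.inv_right ?_)
        · exact (hmx.mul_right hmy).mul_left (hnx.mul_right hny)
        · exact (hmy.mul_right hmx).mul_left (hny.mul_right hnx)
      calc ⁅n * x, m * y⁆ = (n * x * (m * y)) * (m * y * (n * x))⁻¹ := by
            simp only [commutatorElement_def]; group
        _ = n * m * ((x * y) * (y * x)⁻¹) * (m * n)⁻¹ := by rw [a1, a2]; group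
        _ = n * m * (m * n)⁻¹ * ((x * y) * (y * x)⁻¹) := by
            rw [mul_assoc, ← a4.inv_left.eq, ← mul_assoc]
        _ = _ := by simp only [commutatorElement_def]; group
    rw [e, h, h', h1, hnm.eq]
    group

/-- An element of order prime to `p` that centralizes the chief factors of `G` between `N` and the
`p`-subgroup `P` centralizes `P / N`. -/
theorem commutator_mem_of_chief [Finite G] {p : ℕ} [hp : Fact p.Prime] {P N : Subgroup G}
    [N.Normal] (hP : IsPGroup p P) {c : G} {m : ℕ} (hm : ¬ p ∣ m) (hcm : c ^ m = 1)
    (hc : ∀ H K : Subgroup G, IsChiefFactor H K → N ≤ K → H ≤ P → ∀ x ∈ H, ⁅c, x⁆ ∈ K)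
    (L : Subgroup G) (hL : L.Normal) (hNL : N ≤ L) (hLP : L ≤ P) : ∀ x ∈ L, ⁅c, x⁆ ∈ N := by
  induction L using WellFoundedLT.induction with
  | _ L ih =>
    rcases hNL.eq_or_lt with rfl | hlt
    · intro x hx
      rw [commutatorElement_def]
      exact N.mul_mem (hL.conj_mem x hx c) (N.inv_mem hx)
    · obtain ⟨K, hNK, hLK⟩ := exists_isChiefFactor_below inferInstance hL hlt
      have ihK := ih K hLK.lt hLK.normal_bot hNK (hLK.lt.le.trans hLP)
      intro x hx
      have hk : ⁅c, x⁆ ∈ K := hc L K hLK hNK hLP x hx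
      set k := ⁅c, x⁆ with hkdef
      let f := QuotientGroup.mk' N
      have hfx : f c * f x * (f c)⁻¹ = f k * f x := by
        rw [hkdef, commutatorElement_def]; simp
      have hfk : f c * f k * (f c)⁻¹ = f k := by
        have : f ⁅c, k⁆ = 1 := (QuotientGroup.eq_one_iff _).2 (ihK k hk)
        rw [commutatorElement_def] at this
        simpa [mul_inv_eq_one] using this
      -- Modulo `N`, `c` fixes `k`, so conjugation by `c ^ n` multiplies `x` by `k ^ n`. At `n = m`
      -- this gives `k ^ m = 1`, while `k` has `p`-power order.
      have hpow : ∀ n : ℕ, f c ^ n * f x * (f c ^ n)⁻¹ = f k ^ n * f x := by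
        intro n
        induction n with
        | zero => simp
        | succ n ihn =>
          calc f c ^ (n + 1) * f x * (f c ^ (n + 1))⁻¹
              = f c * (f c ^ n * f x * (f c ^ n)⁻¹) * (f c)⁻¹ := by
                rw [pow_succ']; group
            _ = (f c * f k * (f c)⁻¹) ^ n * (f c * f x * (f c)⁻¹) := by
                rw [ihn, conj_pow]; group
            _ = f k ^ (n + 1) * f x := by rw [hfk, hfx, pow_succ, mul_assoc]
      have h1 : f k ^ m = 1 := by
        have := hpow m
        rw [← map_pow, hcm] at this
        simpa using this.symm
      obtain ⟨n, hn⟩ := hP ⟨k, hLP (hLK.lt.le hk)⟩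
      have h2 : f k ^ p ^ n = 1 := by
        have : k ^ p ^ n = 1 := by simpa using congrArg Subtype.val hn
        rw [← map_pow, this, map_one]
      have h3 : f k = 1 := eq_one_of_pow_coprime h2 h1
        (Nat.Coprime.pow_left n ((Nat.Prime.coprime_iff_not_dvd hp.out).2 hm))
      exact (QuotientGroup.eq_one_iff _).1 h3

/-- Let `P` be a normal Sylow `p`-subgroup and let `N ≤ P` be a Frattini minimal normal subgroup
that is contained in every nontrivial normal subgroup. An element that centralizes all chief
factors between `N` and `P` also centralizes `N`. -/
theorem commutator_eq_one_of_frattini [Finite G] {p : ℕ} [hp : Fact p.Prime] {P N : Subgroup G}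
    [P.Normal] [N.Normal] (hP : IsPGroup p P) (hidx : ¬ p ∣ P.index) (hNP : N ≤ P) (hN : N ≠ ⊥)
    (huniq : ∀ L : Subgroup G, L.Normal → L ≠ ⊥ → N ≤ L) (hΦ : N ≤ frattini G) {b : G}
    (hb : ∀ H K : Subgroup G, IsChiefFactor H K → N ≤ K → H ≤ P → ∀ x ∈ H, ⁅b, x⁆ ∈ K) :
    ∀ x ∈ N, ⁅b, x⁆ = 1 := by
  have hPne : P ≠ ⊥ := fun h => hN (le_bot_iff.1 (h ▸ hNP))
  have hNZ : N ≤ centralTorsion p P := huniq _ inferInstance (centralTorsion_ne_bot hP hPne)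
  have hND : N ≤ powersCommutators p P := le_powersCommutators hP hidx hNP hN huniq hΦ
  obtain ⟨n, hn⟩ := IsPGroup.iff_card.1 hP
  have hcop : (Nat.card P).Coprime P.index := by
    rw [hn]
    exact Nat.Coprime.pow_left n ((Nat.Prime.coprime_iff_not_dvd hp.out).2 hidx)
  -- The order of `b ^ Nat.card P` divides `P.index`, so it is prime to `p`. The power `b ^ P.index`
  -- lies in `P` and centralizes `N`; coprimality of the two exponents recovers `b`.
  have hc : ∀ x ∈ P, ⁅b ^ Nat.card P, x⁆ ∈ N := by
    refine commutator_mem_of_chief hP hidx ?_ (fun H K hHK hNK hHP x hx => ?_) P inferInstance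
      hNP le_rfl
    · rw [← pow_mul, P.card_mul_index, pow_card_eq_one']
    · have := hHK.normal_top
      have := hHK.normal_bot
      exact mem_factorCentralizer.1
        (pow_mem (mem_factorCentralizer.2 (hb H K hHK hNK hHP)) _) x hx
  have h1 : b ^ Nat.card P ∈ Subgroup.centralizer (N : Set G) := by
    intro x hx
    exact (Subgroup.mem_centralizer_singleton_iff.1
      (powersCommutators_le_centralizer hNZ hc (hND hx)))
  have h2 : b ^ P.index ∈ Subgroup.centralizer (N : Set G) := fun x hx =>
    (hNZ hx).2.1 _ (P.pow_index_mem b)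
  intro x hx
  have := Subgroup.mem_centralizer_iff.1 (mem_of_pow_coprime h1 h2 hcop) x hx
  rw [commutatorElement_eq_one_iff_mul_comm, this]

end StableSeries

/-! ### Huppert's theorem -/

section Huppert

variable {G : Type u} [Group G]

/-- If a maximal `M` contained the normalizer of `P`, Sylow counting in `G` and in `M` would give
index ≡ 1 mod `p`, impossible for a prime at most `p`. -/
theorem normal_of_prime_index_of_largest [Finite G]
    (h : ∀ M : Subgroup G, IsCoatom M → M.index.Prime) {p : ℕ} [hp : Fact p.Prime]
    (hmax : ∀ q : ℕ, q.Prime → q ∣ Nat.card G → q ≤ p) (P : Sylow p G) :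
    (P : Subgroup G).Normal := by
  rw [← Subgroup.normalizer_eq_top_iff]
  by_contra hne
  obtain ⟨M, hM, hPM⟩ := (eq_top_or_exists_le_coatom _).resolve_left hne
  have hP : (P : Subgroup G) ≤ M := Subgroup.le_normalizer.trans hPM
  have h1 : (Subgroup.normalizer ((P : Subgroup G) : Set G)).index ≡ 1 [MOD p] := by
    have := P.card_eq_index_normalizer
    change _ = (Subgroup.normalizer ((P : Subgroup G) : Set G)).index at this
    rw [← this]
    exact card_sylow_modEq_one p G
  have h2 : (Subgroup.normalizer ((P : Subgroup G) : Set G)).relIndex M ≡ 1 [MOD p] := by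
    have := card_sylow_modEq_one p M
    rw [(P.subtype hP).card_eq_index_normalizer] at this
    rw [Subgroup.relIndex, Subgroup.subgroupOf_normalizer_eq hP]
    exact this
  have h3 := Subgroup.relIndex_mul_index hPM
  have h4 : M.index ≡ 1 [MOD p] := by
    have := h2.mul_right M.index
    rw [h3, one_mul] at this
    exact this.symm.trans h1
  have hq := h M hM
  have hle := hmax _ hq M.index_dvd_card
  have hdvd : p ∣ M.index - 1 := (Nat.modEq_iff_dvd' hq.one_lt.le).1 h4.symm
  have := Nat.le_of_dvd (by have := hq.one_lt; omega) hdvd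
  have := hq.one_lt
  omega

/-- A nontrivial finite group whose maximal subgroups have prime index has a nontrivial normal
Sylow subgroup. -/
theorem exists_normal_sylow [Finite G] [Nontrivial G]
    (h : ∀ M : Subgroup G, IsCoatom M → M.index.Prime) :
    ∃ (p : ℕ) (P : Subgroup G), p.Prime ∧ P.Normal ∧ IsPGroup p P ∧ ¬ p ∣ P.index ∧ P ≠ ⊥ := by
  have hne : (Nat.card G).primeFactors.Nonempty := by
    rw [Nat.nonempty_primeFactors]
    exact Finite.one_lt_card
  obtain ⟨p, hp, hmax⟩ := Finset.exists_max_image _ id hne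
  rw [Nat.mem_primeFactors] at hp
  have : Fact p.Prime := ⟨hp.1⟩
  let P : Sylow p G := default
  have hn := normal_of_prime_index_of_largest h (p := p)
    (fun q hq hdvd => hmax q (Nat.mem_primeFactors.2 ⟨hq, hdvd, hp.2.2⟩)) P
  exact ⟨p, P, hp.1, hn, P.isPGroup', P.not_dvd_index, P.ne_bot_of_dvd_card hp.2.1⟩

/-- `T` is a root of `X ^ p - X`, which splits over the prime field. -/
theorem exists_eigenvector_of_pow_eq_one {p : ℕ} [hp : Fact p.Prime] {V : Type*} [AddCommGroup V]
    [Module (ZMod p) V] [Module.Finite (ZMod p) V] [Nontrivial V] (T : Module.End (ZMod p) V)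
    (hT : T ^ (p - 1) = 1) : ∃ c : ZMod p, ∃ v ≠ 0, T v = c • v := by
  have h0 : (Polynomial.X ^ p - Polynomial.X : Polynomial (ZMod p)) ≠ 0 :=
    FiniteField.X_pow_card_sub_X_ne_zero _ hp.out.one_lt
  have hs : (Polynomial.X ^ p - Polynomial.X : Polynomial (ZMod p)).Splits := by
    have := FiniteField.splits_X_pow_card_sub_X p (K := ZMod p)
    simpa using this
  have hdvd : minpoly (ZMod p) T ∣ Polynomial.X ^ p - Polynomial.X := by
    refine minpoly.dvd _ _ ?_
    have : T ^ (p - 1 + 1) = T := by rw [pow_succ, hT, one_mul]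
    rw [Nat.sub_add_cancel hp.out.one_lt.le] at this
    simp [this]
  obtain ⟨c, hc⟩ := (hs.of_dvd h0 hdvd).exists_eval_eq_zero
    (minpoly.degree_pos (Algebra.IsIntegral.isIntegral T)).ne'
  obtain ⟨v, hv⟩ := (Module.End.hasEigenvalue_of_isRoot hc).exists_hasEigenvector
  exact ⟨c, v, hv.2, hv.apply_eq_smul⟩

theorem exists_apply_eq_nsmul {p : ℕ} [hp : Fact p.Prime] {V : Type*} [AddCommGroup V]
    [Module (ZMod p) V] [Module.Finite (ZMod p) V] [Nontrivial V] (f : V →+ V)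
    (hf : ∀ v, f^[p - 1] v = v) : ∃ k : ℕ, ∃ v ≠ 0, f v = k • v := by
  obtain ⟨k, v, hv, hk⟩ := exists_eigenvector_of_pow_eq_one (f.toZModLinearMap p)
    (LinearMap.ext fun v => by rw [Module.End.pow_apply]; exact hf v)
  refine ⟨k.val, v, hv, hk.trans ?_⟩
  rw [← Nat.cast_smul_eq_nsmul (ZMod p), ZMod.natCast_zmod_val]

theorem exists_apply_eq_pow {A : Type u} [CommGroup A] [Finite A] [Nontrivial A] {p : ℕ}
    [hp : Fact p.Prime] (hpow : ∀ a : A, a ^ p = 1) (f : A →* A) (hf : ∀ a, f^[p - 1] a = a) :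
    ∃ k : ℕ, ∃ x ≠ 1, f x = x ^ k := by
  let m : Module (ZMod p) (Additive A) := AddCommGroup.zmodModule hpow
  exact @exists_apply_eq_nsmul p hp (Additive A) _ m Module.Finite.of_finite inferInstance
    (MonoidHom.toAdditive f) hf

theorem exists_conj_eq_pow [Finite G] {N : Subgroup G} {p : ℕ} [hp : Fact p.Prime] [N.Normal]
    (hN : N ≠ ⊥) (hcomm : ∀ x ∈ N, ∀ y ∈ N, x * y = y * x) (hpow : ∀ x ∈ N, x ^ p = 1) (g : G)
    (hg : ∀ x ∈ N, ⁅g ^ (p - 1), x⁆ = 1) :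
    ∃ k : ℕ, ∃ x ∈ N, x ≠ 1 ∧ g * x * g⁻¹ = x ^ k := by
  let _ : CommGroup N := { mul_comm := fun a b => Subtype.ext (hcomm a a.2 b b.2) }
  have : Nontrivial N := (Subgroup.nontrivial_iff_ne_bot N).2 hN
  obtain ⟨k, x, hx, hk⟩ := exists_apply_eq_pow (A := N) (p := p)
    (fun a => Subtype.ext (hpow a a.2)) (MulAut.conjNormal g : MulAut N).toMonoidHom (fun x => by
      have h1 : ∀ n : ℕ, (((MulAut.conjNormal g : MulAut N).toMonoidHom^[n] x : N) : G)
          = g ^ n * x * (g ^ n)⁻¹ := by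
        intro n
        induction n with
        | zero => simp
        | succ n ih =>
          rw [Function.iterate_succ_apply']
          change g * _ * g⁻¹ = _
          rw [ih, pow_succ']
          group
      have := hg _ x.2
      rw [commutatorElement_def, mul_inv_eq_one] at this
      exact Subtype.ext ((h1 _).trans this))
  exact ⟨k, x, x.2, fun h => hx (Subtype.ext h), congrArg Subtype.val hk⟩

/-- An irreducible elementary abelian normal `p`-subgroup on which `G` induces an abelian group of
exponent dividing `p - 1` is cyclic. -/
theorem IsChiefFactor.isCyclic_of_action [Finite G] {N : Subgroup G} (hc : IsChiefFactor N ⊥)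
    {p : ℕ} [hp : Fact p.Prime] (hcomm : ∀ x ∈ N, ∀ y ∈ N, x * y = y * x)
    (hpow : ∀ x ∈ N, x ^ p = 1) (hab : ∀ a b : G, ∀ x ∈ N, ⁅⁅a, b⁆, x⁆ = 1)
    (hexp : ∀ a : G, ∀ x ∈ N, ⁅a ^ (p - 1), x⁆ = 1) : IsCyclic N := by
  have hn := hc.normal_top
  have hscalar : ∀ g : G, ∃ k : ℕ, ∀ x ∈ N, g * x * g⁻¹ = x ^ k := by
    intro g
    obtain ⟨k, x, hx, hx1, hgx⟩ := exists_conj_eq_pow hc.lt.ne' hcomm hpow g (hexp g)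
    refine ⟨k, ?_⟩
    -- The eigenspace of `g`. It is normal in `G` because commutators act trivially on `N`, so
    -- irreducibility makes `g` a scalar on `N`.
    let E : Subgroup G :=
      { carrier := {x | x ∈ N ∧ g * x * g⁻¹ = x ^ k}
        one_mem' := ⟨N.one_mem, by simp⟩
        mul_mem' := by
          rintro a b ⟨ha, ha'⟩ ⟨hb, hb'⟩
          refine ⟨N.mul_mem ha hb, ?_⟩
          rw [(show Commute a b from hcomm a ha b hb).mul_pow, ← ha', ← hb']
          group
        inv_mem' := by
          rintro a ⟨ha, ha'⟩
          refine ⟨N.inv_mem ha, ?_⟩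
          rw [inv_pow, ← ha']
          group }
    have hE : E.Normal := by
      refine ⟨fun y hy a => ⟨hn.conj_mem y hy.1 a, ?_⟩⟩
      have h1 := hab g a _ (hn.conj_mem _ (hn.conj_mem y hy.1 g) a)
      rw [commutatorElement_eq_one_iff_mul_comm] at h1
      calc g * (a * y * a⁻¹) * g⁻¹
          = ⁅g, a⁆ * (a * (g * y * g⁻¹) * a⁻¹) * ⁅g, a⁆⁻¹ := by
            simp only [commutatorElement_def]; group
        _ = (a * y * a⁻¹) ^ k := by rw [h1, mul_inv_cancel_right, hy.2, conj_pow]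
    rcases hc.eq_or_eq E hE bot_le (fun x hx => hx.1) with h | h
    · exact absurd (Subgroup.mem_bot.1 (h ▸ (⟨hx, hgx⟩ : x ∈ E))) hx1
    · intro y hy
      rw [← h] at hy
      exact hy.2
  obtain ⟨x, hx, hx1⟩ := N.bot_or_exists_ne_one.resolve_left hc.lt.ne'
  -- As all of `G` acts by scalars, every cyclic subgroup of `N` is normal.
  have hz : (Subgroup.zpowers (x : G)).Normal := by
    refine ⟨fun y hy g => ?_⟩
    obtain ⟨k, hk⟩ := hscalar g
    rw [hk y ((Subgroup.zpowers_le.2 hx) hy)]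
    exact pow_mem hy k
  rcases hc.eq_or_eq _ hz bot_le (Subgroup.zpowers_le.2 hx) with h | h
  · exact absurd (Subgroup.zpowers_eq_bot.1 h) hx1
  · rw [← h]
    infer_instance

theorem isCyclic_of_inf_eq_bot {H L : Subgroup G} [L.Normal] (h : H ⊓ L = ⊥)
    (hc : IsCyclic (H.map (QuotientGroup.mk' L))) : IsCyclic H := by
  refine isCyclic_of_injective ((QuotientGroup.mk' L).subgroupMap H) fun a b hab => ?_
  have h1 : QuotientGroup.mk' L a = QuotientGroup.mk' L b := congrArg Subtype.val hab
  have h2 : ((a : G)⁻¹ * b) ∈ H ⊓ L := ⟨H.mul_mem (H.inv_mem a.2) b.2, QuotientGroup.eq.1 h1⟩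
  rw [h, Subgroup.mem_bot, inv_mul_eq_one] at h2
  exact Subtype.ext h2

theorem IsChiefFactor.isCyclic_of_bot {N : Subgroup G} (hc : IsChiefFactor N ⊥)
    (hG : IsSupersoluble G) : IsCyclic N :=
  isCyclic_of_inf_eq_bot (inf_bot_eq N) (hc.isCyclic hG)

theorem IsChiefFactor.le_or_inf_eq_bot {N : Subgroup G} (hc : IsChiefFactor N ⊥)
    {L : Subgroup G} (hL : L.Normal) : N ≤ L ∨ N ⊓ L = ⊥ := by
  have := hc.normal_top
  exact (hc.eq_or_eq (N ⊓ L) inferInstance bot_le inf_le_left).symm.imp inf_eq_left.1 id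

/-- Huppert's theorem: a finite group whose maximal subgroups have prime index is supersoluble. -/
theorem isSupersoluble_of_prime_index [Finite G]
    (h : ∀ M : Subgroup G, IsCoatom M → M.index.Prime) : IsSupersoluble G := by
  induction hcard : Nat.card G using Nat.strong_induction_on generalizing G with
  | _ n ih =>
    rcases subsingleton_or_nontrivial G with hG | hG
    · exact isSupersoluble_of_subsingleton
    have hquot : ∀ (L : Subgroup G) [L.Normal], L ≠ ⊥ → IsSupersoluble (G ⧸ L) := by
      intro L _ hL
      refine ih _ (hcard ▸ card_quotient_lt hL) (fun M hM => ?_) rfl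
      have hs := QuotientGroup.mk'_surjective L
      rw [← Subgroup.index_comap_of_surjective M hs]
      exact h _ ((isCoatom_comap_iff hs).2 hM)
    obtain ⟨p, P, hp, hPn, hP, hidx, hPne⟩ := exists_normal_sylow h
    have := Fact.mk hp
    obtain ⟨N, hNZ, hc⟩ := exists_isChiefFactor_above (K := (⊥ : Subgroup G)) inferInstance
      (inferInstance : (centralTorsion p P).Normal)
      (bot_lt_iff_ne_bot.2 (centralTorsion_ne_bot hP hPne))
    have hNn := hc.normal_top
    have hNP : N ≤ P := fun x hx => (hNZ hx).1
    have hcomm : ∀ x ∈ N, ∀ y ∈ N, x * y = y * x := fun x hx y hy => (hNZ hx).2.1 y (hNP hy)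
    suffices hcyc : IsCyclic N from .of_quotient hcyc (hquot N hc.lt.ne')
    by_cases huniq : ∀ L : Subgroup G, L.Normal → L ≠ ⊥ → N ≤ L
    · by_cases hΦ : N ≤ frattini G
      · have hcent : ∀ b : G, (∀ (H K : Subgroup G) [H.Normal] [K.Normal], IsChiefFactor H K →
            K.relIndex H = p → b ∈ factorCentralizer H K) → ∀ x ∈ N, ⁅b, x⁆ = 1 := by
          intro b hb
          refine commutator_eq_one_of_frattini hP hidx hNP hc.lt.ne' huniq hΦ
            fun H K hHK hNK hHP => ?_
          have := hHK.normal_top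
          have := hHK.normal_bot
          refine mem_factorCentralizer.1 (hb H K hHK ?_)
          have hpr := prime_card_of_isCyclic (isChiefFactor_map_mk'_bot hHK)
            ((isChiefFactor_map_mk'_bot hHK).isCyclic_of_bot
              (hquot K (ne_bot_of_le_ne_bot hc.lt.ne' hNK)))
          rw [card_map_mk'] at hpr
          obtain ⟨m, hm⟩ := IsPGroup.iff_card.1 (hP.to_le hHP)
          exact (Nat.prime_dvd_prime_iff_eq hpr hp).1
            (hpr.dvd_of_dvd_pow (hm ▸ Subgroup.relIndex_dvd_card K H))
        exact hc.isCyclic_of_action hcomm (fun x hx => (hNZ hx).2.2)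
          (fun a b => hcent _ fun H K _ _ _ hr => (factorCentralizer_of_prime hr a b).1)
          (fun a => hcent _ fun H K _ _ _ hr => (factorCentralizer_of_prime hr a 1).2)
      -- A non-Frattini `N` is complemented by a maximal subgroup, so |N| is its prime index.
      · obtain ⟨M, hM, hNM⟩ := not_le_frattini_iff.1 hΦ
        have htop : M ⊔ N = ⊤ := hM.2 _ (left_lt_sup.2 hNM)
        have hn : (N ⊓ M).Normal := by
          refine ⟨fun x hx g => ?_⟩
          obtain ⟨m, hm, y, hy, rfl⟩ :=
            Subgroup.mem_sup_of_normal_right.1 (htop ▸ Subgroup.mem_top g : g ∈ M ⊔ N)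
          have : m * y * x * (m * y)⁻¹ = m * x * m⁻¹ := by
            rw [mul_assoc m y x, hcomm y hy x hx.1]; group
          rw [this]
          exact ⟨hNn.conj_mem x hx.1 m, M.mul_mem (M.mul_mem hm hx.2) (M.inv_mem hm)⟩
        have hbot : N ⊓ M = ⊥ := (hc.eq_or_eq _ hn bot_le inf_le_left).resolve_right
          fun h => hNM (inf_eq_left.1 h)
        have hpr := h M hM
        rw [index_eq_relIndex_of_sup_eq_top htop, ← Subgroup.inf_relIndex_right, inf_comm, hbot,
          Subgroup.relIndex_bot_left] at hpr
        have := Fact.mk hpr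
        exact isCyclic_of_prime_card rfl
    -- Here `N` embeds in `G ⧸ L` as a minimal normal subgroup, and induction applies.
    · push Not at huniq
      obtain ⟨L, hL, hL1, hNL⟩ := huniq
      have hdisj := (hc.le_or_inf_eq_bot hL).resolve_left hNL
      refine isCyclic_of_inf_eq_bot hdisj ?_
      rw [← show (N ⊔ L).map (QuotientGroup.mk' L) = N.map (QuotientGroup.mk' L) by
        rw [Subgroup.map_sup, QuotientGroup.map_mk'_self, sup_bot_eq]]
      have := isChiefFactor_map_mk'_bot (hc.sup hL hdisj)
      exact this.isCyclic_of_bot (hquot L hL1)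

end Huppert

/-! ### Nearly nilpotent groups -/

section NearlyNilpotent

variable {G : Type u} [Group G]

instance factorCentralizer_normal (H K : Subgroup G) [H.Normal] [K.Normal] :
    (factorCentralizer H K).Normal :=
  inferInstanceAs (MonoidHom.ker _).Normal

/-- In a finite supersoluble group, an element that centralizes every non-Frattini chief factor
centralizes every chief factor. -/
theorem IsSupersoluble.mem_factorCentralizer_of_nonFrattini [Finite G] (hG : IsSupersoluble G)
    {b : G} (hb : ∀ (H K : Subgroup G) [H.Normal] [K.Normal], IsChiefFactor H K →
      ∀ M : Subgroup G, IsCoatom M → K ≤ M → ¬ H ≤ M → b ∈ factorCentralizer H K)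
    (H K : Subgroup G) [H.Normal] [K.Normal] (hHK : IsChiefFactor H K) :
    b ∈ factorCentralizer H K := by
  induction hcard : Nat.card G using Nat.strong_induction_on generalizing G with
  | _ n ih =>
    have hquot : ∀ (L : Subgroup G), L.Normal → L ≠ ⊥ → ∀ (H K : Subgroup G) [H.Normal]
        [K.Normal], L ≤ K → IsChiefFactor H K → b ∈ factorCentralizer H K := by
      intro L hL hL1 H K hH hK hLK hHK
      have hs := QuotientGroup.mk'_surjective L
      obtain ⟨K', rfl⟩ := exists_eq_comap (f := QuotientGroup.mk' L) (L := K) (by simpa using hLK)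
      obtain ⟨H', rfl⟩ := exists_eq_comap (f := QuotientGroup.mk' L) (L := H)
        (by simpa using hLK.trans hHK.lt.le)
      have := normal_of_normal_comap hs hH
      have := normal_of_normal_comap hs hK
      rw [factorCentralizer_comap hs, Subgroup.mem_comap]
      refine ih _ (hcard ▸ card_quotient_lt hL1) (hG.of_surjective hs)
        (fun H₁ K₁ _ _ hc M hM h1 h2 => ?_) H' K' ((isChiefFactor_comap_iff hs).1 hHK) rfl
      rw [← Subgroup.mem_comap, ← factorCentralizer_comap hs]
      exact hb _ _ ((isChiefFactor_comap_iff hs).2 hc) _ ((isCoatom_comap_iff hs).2 hM)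
        (Subgroup.comap_mono h1) (by rwa [Subgroup.comap_le_comap_of_surjective hs])
    by_cases hK : K = ⊥
    · subst hK
      by_cases huniq : ∀ L : Subgroup G, L.Normal → L ≠ ⊥ → H ≤ L
      · by_cases hΦ : H ≤ frattini G
        · have : Nontrivial G := by
            obtain ⟨x, -, hx⟩ := H.bot_or_exists_ne_one.resolve_left hHK.lt.ne'
            exact ⟨x, 1, hx⟩
          obtain ⟨p, P, hp, hPn, hP, hidx, hPne⟩ := exists_normal_sylow fun M => hG.prime_index
          have := Fact.mk hp
          refine mem_factorCentralizer.2 fun x hx => Subgroup.mem_bot.2 ?_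
          -- Only the monolithic Frattini case is not inherited from a quotient; the factors above
          -- `H` are covered by induction in `G ⧸ H`.
          refine commutator_eq_one_of_frattini hP hidx (huniq P hPn hPne) hHK.lt.ne' huniq hΦ
            (fun H₁ K₁ hc h1 _ => ?_) x hx
          have := hc.normal_top
          have := hc.normal_bot
          exact mem_factorCentralizer.1 (hquot H inferInstance hHK.lt.ne' H₁ K₁ h1 hc)
        · obtain ⟨M, hM, hHM⟩ := not_le_frattini_iff.1 hΦ
          exact hb H ⊥ hHK M hM bot_le hHM
      · push Not at huniq
        obtain ⟨L, hL, hL1, hHL⟩ := huniq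
        have hdisj := (hHK.le_or_inf_eq_bot hL).resolve_left hHL
        rw [← factorCentralizer_sup hdisj]
        exact hquot L hL hL1 _ _ le_rfl (hHK.sup hL hdisj)
    · exact hquot K inferInstance hK H K le_rfl hHK

theorem IsChiefFactor.isCyclic_inducedAut [Finite G] {H K : Subgroup G} [H.Normal] [K.Normal]
    (hc : IsChiefFactor H K) (hG : IsSupersoluble G) : IsCyclic (inducedAut H K) := by
  have hp := hc.prime_card hG
  have := Fact.mk hp
  have := hc.isCyclic hG
  have : IsCyclic (MulAut (H.map (QuotientGroup.mk' K))) :=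
    isCyclic_of_injective (IsCyclic.mulAutMulEquiv (H.map (QuotientGroup.mk' K))).toMonoidHom
      (MulEquiv.injective _)
  infer_instance

theorem IsNearlyNilpotent.isStronglySupersoluble [Finite G] (hG : IsNearlyNilpotent G) :
    IsStronglySupersoluble G := by
  refine ⟨hG.1, fun H K _ _ hc => ?_⟩
  set e := UniqueFactorizationMonoid.radical (Nat.card G) with he
  have hcent : ∀ g : G, g ^ e ∈ factorCentralizer H K := by
    intro g
    refine hG.1.mem_factorCentralizer_of_nonFrattini (fun H K _ _ hc M hM h1 h2 => ?_) H K hc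
    obtain ⟨p, hp, hdvd⟩ := (isNearlyNilpotent_iff.1 hG).2 H K hc M hM h1 h2
    -- The index is 1 or a prime divisor of |G|, so it divides the radical.
    have hdvd' : (factorCentralizer H K).index ∣ e := by
      rcases (Nat.dvd_prime hp).1 hdvd with h | h
      · rw [h]
        exact one_dvd _
      · rw [h, he, UniqueFactorizationMonoid.dvd_radical_iff_of_irreducible hp.prime.irreducible
          Nat.card_pos.ne', ← h]
        exact Subgroup.index_dvd_card _
    obtain ⟨m, hm⟩ := hdvd'
    rw [hm, pow_mul]
    exact pow_mem (Subgroup.pow_index_mem _ g) m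
  have := hc.isCyclic_inducedAut hG.1
  rw [← IsCyclic.exponent_eq_card]
  refine Squarefree.squarefree_of_dvd (Monoid.exponent_dvd_of_forall_pow_eq_one ?_)
    (UniqueFactorizationMonoid.squarefree_radical (a := Nat.card G))
  rintro ⟨_, g, rfl⟩
  refine Subtype.ext ?_
  have := hcent g
  rw [factorCentralizer, MonoidHom.mem_ker, map_pow] at this
  exact this

theorem IsNearlyNilpotent.of_surjective {Q : Type v} [Group Q] (hG : IsNearlyNilpotent G)
    {f : G →* Q} (hf : Function.Surjective f) : IsNearlyNilpotent Q := by
  rw [isNearlyNilpotent_iff] at hG ⊢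
  refine ⟨hG.1.of_surjective hf, fun H K _ _ hc M hM h1 h2 => ?_⟩
  obtain ⟨p, hp, h⟩ := hG.2 (H.comap f) (K.comap f) ((isChiefFactor_comap_iff hf).2 hc)
    (M.comap f) ((isCoatom_comap_iff hf).2 hM) (Subgroup.comap_mono h1)
    (by rwa [Subgroup.comap_le_comap_of_surjective hf])
  rw [factorCentralizer_comap hf, Subgroup.index_comap_of_surjective _ hf] at h
  exact ⟨p, hp, h⟩

theorem isNearlyNilpotent_of_quotient_normalCore [Finite G]
    (h : ∀ M : Subgroup G, IsCoatom M → IsNearlyNilpotent (G ⧸ M.normalCore)) :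
    IsNearlyNilpotent G := by
  rw [isNearlyNilpotent_iff]
  constructor
  · refine isSupersoluble_of_prime_index fun M hM => ?_
    have hs := QuotientGroup.mk'_surjective M.normalCore
    obtain ⟨M', hM'⟩ := exists_eq_comap (f := QuotientGroup.mk' M.normalCore) (L := M)
      (by simpa using M.normalCore_le)
    have hi : M.index = M'.index := by
      conv_lhs => rw [hM']
      exact Subgroup.index_comap_of_surjective _ hs
    rw [hi]
    exact (h M hM).1.prime_index ((isCoatom_comap_iff hs).1 (hM' ▸ hM))
  · intro H K _ _ hc M hM hKM hHM
    -- `K` lies in the core because it is normal and below `M`; the intersection is not `H` because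
    -- `M` does not contain `H`.
    have hHR : H ⊓ M.normalCore = K := by
      refine (hc.eq_or_eq _ inferInstance
        (le_inf hc.lt.le (Subgroup.normal_le_normalCore.2 hKM)) inf_le_left).resolve_right ?_
      exact fun he => hHM ((inf_eq_left.1 he).trans M.normalCore_le)
    rw [← factorCentralizer_sup hHR]
    have hc' := hc.sup inferInstance hHR
    have key : ∀ (H K M : Subgroup G) [H.Normal] [K.Normal] (R : Subgroup G) [R.Normal],
        IsNearlyNilpotent (G ⧸ R) → R ≤ K → IsChiefFactor H K → IsCoatom M → K ≤ M → ¬ H ≤ M →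
        ∃ p : ℕ, p.Prime ∧ (factorCentralizer H K).index ∣ p := by
      intro H K M hH hK R _ hR hRK hc hM hKM hHM
      have hs := QuotientGroup.mk'_surjective R
      obtain ⟨K', rfl⟩ := exists_eq_comap (f := QuotientGroup.mk' R) (L := K) (by simpa using hRK)
      obtain ⟨H', rfl⟩ := exists_eq_comap (f := QuotientGroup.mk' R) (L := H)
        (by simpa using hRK.trans hc.lt.le)
      obtain ⟨M', rfl⟩ := exists_eq_comap (f := QuotientGroup.mk' R) (L := M)
        (by simpa using hRK.trans hKM)
      have := normal_of_normal_comap hs hH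
      have := normal_of_normal_comap hs hK
      rw [factorCentralizer_comap hs, Subgroup.index_comap_of_surjective _ hs]
      rw [Subgroup.comap_le_comap_of_surjective hs] at hKM hHM
      exact (isNearlyNilpotent_iff.1 hR).2 H' K' ((isChiefFactor_comap_iff hs).1 hc) M'
        ((isCoatom_comap_iff hs).1 hM) hKM hHM
    exact key _ _ M M.normalCore (h M hM) le_rfl hc' hM M.normalCore_le
      fun hle => hHM (le_sup_left.trans hle)

theorem isNearlyNilpotent_of_quotient_frattini [Finite G]
    (h : IsNearlyNilpotent (G ⧸ frattini G)) : IsNearlyNilpotent G := by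
  refine isNearlyNilpotent_of_quotient_normalCore fun M hM => ?_
  have hle : frattini G ≤ M.normalCore := Subgroup.normal_le_normalCore.2 (frattini_le_coatom hM)
  refine h.of_surjective (f := QuotientGroup.map _ _ (MonoidHom.id G) hle) ?_
  rintro ⟨x⟩
  exact ⟨QuotientGroup.mk x, rfl⟩

end NearlyNilpotent

theorem proposition2p9 :
    IsSchunckClass.{u} (fun G _ _ => IsNearlyNilpotent G) ∧
    (∀ (G : Type u) [Group G] [Finite G], IsNearlyNilpotent G → IsStronglySupersoluble G) ∧
    (∀ (G : Type u) (Q : Type v) [Group G] [Finite G] [Group Q] (f : G →* Q),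
      Function.Surjective f → IsNearlyNilpotent G → IsNearlyNilpotent Q) ∧
    (∀ (G : Type u) [Group G] [Finite G],
      IsNearlyNilpotent (G ⧸ frattini G) → IsNearlyNilpotent G) := by
  refine ⟨⟨fun G H _ _ _ _ e h => h.of_surjective (f := e.toMonoidHom) e.surjective,
    fun G _ _ h => h.1.isSolvable, fun G _ _ => ⟨fun h M _ => ?_, fun h => ?_⟩⟩,
    fun G _ _ h => h.isStronglySupersoluble, fun G Q _ _ _ f hf h => h.of_surjective hf,
    fun G _ _ h => isNearlyNilpotent_of_quotient_frattini h⟩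
  · exact h.of_surjective (QuotientGroup.mk'_surjective _)
  · exact isNearlyNilpotent_of_quotient_normalCore h
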